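/- **Theorem (revelation principle for untimed private communication equilibrium).** Consider a finite extensive-form game with finitely many players $i$, possibly with chance moves, with perfect recall, a utility function $u_i$ on the set $Z$ of terminal nodes for every player, and nonempty finite action sets. *Decision problems.* Player $i$'s tree-form decision problem has as decision points the infosets $j \in \mathcal J_i$ of player $i$, with action set $A_j$, and as observation points $\Sigma_i = \{\varnothing\} \cup \{ja : j \in \mathcal J_i,\ a \in A_j\}$. Let $\mathcal X_i \subseteq \{0,1\}^{\Sigma_i}$ be the set of sequence-form pure strategies ($x(\sigma) = 1$ iff the player selects every action on the path $\varnothing \to \sigma$). For a profile of (mixed) sequence-form strategies $x_i \in \operatorname{co} \mathcal X_i$, the terminal node $z$ is reached with probability $c(z) \prod_i x_i(\sigma_i(z))$, where $c(z)$ is the product of the chance probabilities on the path to $z$ and $\sigma_i(z)$ is the last observation point of player $i$ on that path; $u_i(x_1,\dots,x_n)$ denotes the resulting expected utility. *Mediators.* For every player $i$ let $S_i$ be an arbitrary set of messages containing $\mathcal J_i \sqcup \Sigma_i \sqcup \{\bot\}$, and let $H_i \in \mathbb N$ be at least the depth of (number of edges from the root to) every decision point of player $i$'s decision problem. A mediator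 of player $i$ is a map $M_i : S_i^{\le H_i} \to S_i$, which gives the reply to each message history (the player's messages and the mediator's replies in chronological order, ending with the player's current message). Let $\mathcal M_i$ be the set of these mediators. *Untimed interactions.* An untimed player $i$, upon reaching a decision point $j$, may send any number of messages (subject to the bound $H_i$ on the length of histories), receiving a reply from the mediator to each, before it plays an action in $A_j$. A pure strategy thus chooses, as a function of $j$ and of the current message history, whether to send a message (and which) or to play an action (and which). A mixed strategy, i.e. a discrete probability distribution over pure strategies, induces the function $\varphi : \mathcal M_i \to \operatorname{co} \mathcal X_i$, where $\varphi(M)(\sigma)$ is the probability that the player plays all the actions on the path to $\sigma$ when interacting with $M$. Let $\Phi_i$ be the set of all functions so induced. *Equilibrium.* An untimed private communication equilibrium is a tuple $(\pi, \varphi_1, \dots, \varphi_n)$ with $\pi$ a discrete probability distribution on $\mathcal M_1 \times \dots \times \mathcal M_n$ and $\varphi_i \in \Phi_i$, such that for every player $i$ and every $\varphi_i' \in \Phi_i$, $$\mathbb E_{(M_1,\dots,M_n) \sim \pi}\bigl[u_i(\varphi_i'(M_i), \varphi_{-i}(M_{-i})) - u_i(\varphi_i(M_i), \varphi_{-i}(M_{-i}))\bigr]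 \le 0 .$$ The direct mediator $M_i^{x}$ of $x \in \mathcal X_i$ replies to a message history $s$ as follows: if $s = (j^{(1)}, a^{(1)}, j^{(2)}, a^{(2)}, \dots, j)$ is the path to a decision point $j$ of player $i$ and $x$ recommends an action $a$ at $j$ (that is, $x(ja) = 1$), it replies $a$; otherwise it replies $\bot$ (an action $a$ at $j$ being sent as the message $ja \in \Sigma_i$). The equilibrium is direct if $\pi$ is supported on profiles of direct mediators and $\varphi_i(M_i^{x}) = x$ for every player $i$ and every $x \in \mathcal X_i$. **Claim.** For every untimed private communication equilibrium $(\pi, \varphi_1, \dots, \varphi_n)$ there is a direct untimed private communication equilibrium $(\pi^*, \varphi_1^*, \dots, \varphi_n^*)$, with the same message sets $S_i$ and bounds $H_i$, that is outcome-equivalent to it: both induce the same probability distribution over the terminal nodes of the game. -/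

import Mathlib

/-! ### Tree-form decision problems -/

/-- A (rooted, tree-form) decision problem. `J` is the set of decision points and `A j` the set of
actions at `j`. The tree is presented through its root paths: `path j` lists, in order, the pairs
(decision point, action taken there) on the path from the root to `j`. Every initial segment of a
root path is again a root path. -/
structure DecisionProblem where
  J : Type*
  A : J → Type*
  finite_action : ∀ j, Finite (A j)
  nonempty_action : ∀ j, Nonempty (A j)
  path : J → List (Σ j, A j)
  path_of_path_eq : ∀ j l m, path j = l ++ [m] → path m.1 = l

namespace DecisionProblem

/-- Observation points (sequences): `none` is the root `∅`, and `some ⟨j, a⟩` is the point `ja`. -/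
abbrev Seq (D : DecisionProblem) := Option (Σ j, D.A j)

/-- The moves on the path from the root to an observation point. -/
def seqPath (D : DecisionProblem) : D.Seq → List (Σ j, D.A j)
  | none => []
  | some m => D.path m.1 ++ [m]

/-- The depth (number of edges below the root) of a decision point: each earlier decision point on
its path is followed by an observation point, and the root is an observation point. -/
def depth (D : DecisionProblem) (j : D.J) : ℕ := 2 * (D.path j).length + 1

open Classical in
/-- The sequence-form vector of a choice `s` of one action at every decision point. -/
noncomputable def seqForm (D : DecisionProblem) (s : ∀ j, D.A j) : D.Seq → ℝ :=
  fun σ => if ∀ m ∈ D.seqPath σ, s m.1 = m.2 then 1 else 0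

/-- The set `X` of sequence-form pure strategies. -/
def pureStrategies (D : DecisionProblem) : Set (D.Seq → ℝ) := Set.range D.seqForm

end DecisionProblem

/-! ### Expectations under discrete distributions -/

/-- The expectation of a real function under a discrete probability distribution. -/
noncomputable def pmfExpect {α : Type*} (p : PMF α) (f : α → ℝ) : ℝ := ∑' a, (p a).toReal * f a

/-! ### Mediators and untimed interaction with a mediator -/

/-- A mediator with message set `S` and horizon `H`: it answers every message history (messages of
the player and earlier replies in chronological order, the last entry being the player's current
message) of length at most `H`. -/
abbrev Mediator (S : Type*) (H : ℕ) := {s : List S // s.length ≤ H} → S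

/-- A pure strategy of a player who may send any number of messages upon reaching a decision point.
At the real decision point `j`, with current message history `h` (messages and replies), the player
either plays an action at `j`, or sends a further message, as long as the horizon permits. -/
def UntimedStrategy (D : DecisionProblem) (S : Type*) (H : ℕ) :=
  ∀ (j : D.J) (h : List S), D.A j ⊕ {_m : S // h.length < H}

namespace UntimedStrategy

variable {D : DecisionProblem} {S : Type*} {H : ℕ}

/-- What happens at decision point `j` when it is reached with message history `h`: the action
finally played, and the message history at that time. -/
def act (f : UntimedStrategy D S H) (M : Mediator S H) (j : D.J) (h : List S) :
    D.A j × List S :=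
  match f j h with
  | Sum.inl a => (a, h)
  | Sum.inr ⟨m, hm⟩ =>
      f.act M j ((h ++ [m]) ++ [M ⟨h ++ [m], by simp; omega⟩])
termination_by H - h.length
decreasing_by simp; omega

/-- Starting with message history `h`, the player plays all the actions in the given list of moves,
when the corresponding decision points are reached one after the other. -/
def Plays (f : UntimedStrategy D S H) (M : Mediator S H) :
    List (Σ j, D.A j) → List S → Prop
  | [], _ => True
  | m :: l, h => (f.act M m.1 h).1 = m.2 ∧ f.Plays M l (f.act M m.1 h).2

end UntimedStrategy

open Classical in
/-- The function from mediators to (mixed) sequence-form strategies induced by a mixed strategy of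
the untimed player: its value at `M` and `σ` is the probability that the player plays all actions on
the path to `σ` when it interacts with `M`. -/
noncomputable def untimedMap (D : DecisionProblem) {S : Type*} {H : ℕ}
    (μ : PMF (UntimedStrategy D S H)) (M : Mediator S H) : D.Seq → ℝ :=
  fun σ => pmfExpect μ fun f => if f.Plays M (D.seqPath σ) [] then 1 else 0

/-- The set `Φ` of untimed interactions, as functions of the mediator. -/
def untimedInteractions (D : DecisionProblem) (S : Type*) (H : ℕ) :
    Set (Mediator S H → D.Seq → ℝ) :=
  Set.range (untimedMap D)

namespace DecisionProblem

variable (D : DecisionProblem) {S : Type*}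

/-- The basic messages: decision points, observation points, and the empty message `⊥`. -/
abbrev BasicMessage := D.J ⊕ D.Seq ⊕ Unit

/-- The message history `(j₁, a₁, j₂, a₂, …, j)` along the path to decision point `j`; the action
`aₖ` at `jₖ` is represented by the observation point `jₖaₖ`. -/
def pathMessages (e : D.BasicMessage ↪ S) (j : D.J) : List S :=
  (D.path j).flatMap (fun m => [e (Sum.inl m.1), e (Sum.inr (Sum.inl (some m)))]) ++
    [e (Sum.inl j)]

open Classical in
/-- The direct mediator of a pure strategy `x`: if the message history is the path to a decision
point `j` and `x` recommends an action `a` at `j` (that is, `x(ja) = 1`), the reply is that action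
(represented by `ja`); otherwise the reply is `⊥`. -/
noncomputable def directMediator (e : D.BasicMessage ↪ S) (H : ℕ) (x : D.Seq → ℝ) :
    Mediator S H := fun s =>
  if h : ∃ m : Σ j, D.A j, s.1 = D.pathMessages e m.1 ∧ x (some m) = 1 then
    e (Sum.inr (Sum.inl (some h.choose)))
  else e (Sum.inr (Sum.inr ()))

end DecisionProblem

/-! ### Extensive-form games -/

/-- Finite game trees with players `ι`, infoset labels `I i` for player `i`, and actions `A i j` at
infoset `j` of player `i`. A nonterminal node is either a chance node with a distribution over its
children, or belongs to an infoset of some player, and has one child for each action there. -/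
inductive GameTree {ι : Type*} (I : ι → Type*) (A : ∀ i, I i → Type*) where
  | leaf : GameTree I A
  | chance (n : ℕ) (p : PMF (Fin n)) (child : Fin n → GameTree I A) : GameTree I A
  | decision (i : ι) (j : I i) (child : A i j → GameTree I A) : GameTree I A

section Moves

variable {ι : Type*} {I : ι → Type*} {A : ∀ i, I i → Type*}

open Classical in
/-- The moves of player `i` in a list of moves of all players. -/
noncomputable def ownMoves (i : ι) (l : List (Σ i, Σ j : I i, A i j)) : List (Σ j : I i, A i j) :=
  l.filterMap fun m => if h : m.1 = i then some (h ▸ m.2) else none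

end Moves

namespace GameTree

universe u v w

variable {ι : Type u} {I : ι → Type v} {A : ∀ i, I i → Type w}

/-- `T.Reaches l T'`: there is a node of `T` with subtree `T'` such that the moves of the players
on the way from the root to this node are `l`. -/
inductive Reaches : GameTree I A → List (Σ i, Σ j : I i, A i j) → GameTree I A → Prop
  | refl (T : GameTree I A) : Reaches T [] T
  | chance {n : ℕ} {p : PMF (Fin n)} {child : Fin n → GameTree I A} {l : List _}
      {T : GameTree I A} (k : Fin n) (h : Reaches (child k) l T) :
      Reaches (GameTree.chance n p child) l T
  | decision {i : ι} {j : I i} {child : A i j → GameTree I A} {l : List _}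
      {T : GameTree I A} (a : A i j) (h : Reaches (child a) l T) :
      Reaches (GameTree.decision i j child) (⟨i, j, a⟩ :: l) T

/-- The terminal nodes of a game tree. -/
def Terminal : GameTree I A → Type w
  | leaf => PUnit
  | chance n _ child => Σ k : Fin n, (child k).Terminal
  | decision i j child => Σ a : A i j, (child a).Terminal

/-- The moves of the players on the path to a terminal node. -/
def moves : (T : GameTree I A) → T.Terminal → List (Σ i, Σ j : I i, A i j)
  | leaf, _ => []
  | chance _ _ child, z => (child z.1).moves z.2
  | decision i j child, z => ⟨i, j, z.1⟩ :: (child z.1).moves z.2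

/-- The product of the probabilities of the chance moves on the path to a terminal node. -/
noncomputable def chanceProb : (T : GameTree I A) → T.Terminal → ℝ
  | leaf, _ => 1
  | chance _ p child, z => (p z.1).toReal * (child z.1).chanceProb z.2
  | decision _ _ child, z => (child z.1).chanceProb z.2

theorem finite_terminal (hA : ∀ i j, Finite (A i j)) : (T : GameTree I A) → Finite T.Terminal
  | leaf => inferInstanceAs (Finite PUnit)
  | chance n _ child =>
      have : ∀ k, Finite (child k).Terminal := fun k => finite_terminal hA (child k)
      inferInstanceAs (Finite (Σ k : Fin n, (child k).Terminal))
  | decision i j child =>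
      have := hA i j
      have : ∀ a, Finite (child a).Terminal := fun a => finite_terminal hA (child a)
      inferInstanceAs (Finite (Σ a : A i j, (child a).Terminal))

/-- Every move of a player on the way to a node was made at an earlier node. -/
theorem Reaches.exists_of_ownMoves {T T' : GameTree I A} {L : List (Σ i, Σ j : I i, A i j)}
    (h : T.Reaches L T') (i : ι) :
    ∀ (l : List (Σ j : I i, A i j)) (m : Σ j : I i, A i j), ownMoves i L = l ++ [m] →
      ∃ L' child, T.Reaches L' (GameTree.decision i m.1 child) ∧ ownMoves i L' = l := by
  induction h with
  | refl T => intro l m hl; simp [ownMoves] at hl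
  | chance k _ ih =>
    intro l m hl
    obtain ⟨L', child, h1, h2⟩ := ih l m hl
    exact ⟨L', child, .chance k h1, h2⟩
  | @decision i' j child L T a _ ih =>
    intro l m hl
    by_cases hi : i' = i
    · subst hi
      have hc : ∀ L', ownMoves i' (⟨i', j, a⟩ :: L') = ⟨j, a⟩ :: ownMoves i' L' := by
        intro L'; simp [ownMoves]
      rw [hc] at hl
      cases l with
      | nil =>
        simp only [List.nil_append, List.cons.injEq] at hl
        obtain ⟨rfl, _⟩ := hl
        exact ⟨[], child, .refl _, by simp [ownMoves]⟩
      | cons m' l' =>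
        simp only [List.cons_append, List.cons.injEq] at hl
        obtain ⟨L', ch, h1, h2⟩ := ih l' m hl.2
        exact ⟨_, ch, .decision a h1, by rw [hc, h2, hl.1]⟩
    · have hc : ∀ L', ownMoves i (⟨i', j, a⟩ :: L') = ownMoves i L' := by
        intro L'; simp [ownMoves, hi]
      rw [hc] at hl
      obtain ⟨L', ch, h1, h2⟩ := ih l m hl
      exact ⟨_, ch, .decision a h1, by rw [hc, h2]⟩

end GameTree

/-- A finite extensive-form game with perfect recall and set of players `ι`. -/
structure ExtensiveFormGame (ι : Type*) where
  Infoset : ι → Type*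
  Act : ∀ i, Infoset i → Type*
  finite_act : ∀ i j, Finite (Act i j)
  nonempty_act : ∀ i j, Nonempty (Act i j)
  tree : GameTree Infoset Act
  utility : ι → tree.Terminal → ℝ
  /-- Every infoset contains a node. -/
  infoset_nonempty : ∀ i j, ∃ l child, tree.Reaches l (GameTree.decision i j child)
  /-- Perfect recall: a player has the same own past (infosets visited and actions taken there) at
  all nodes of an infoset. -/
  perfect_recall : ∀ i j l child l' child',
    tree.Reaches l (GameTree.decision i j child) →
    tree.Reaches l' (GameTree.decision i j child') → ownMoves i l = ownMoves i l'

namespace ExtensiveFormGame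

variable {ι : Type*} (G : ExtensiveFormGame ι)

/-- The terminal nodes of the game. -/
abbrev Terminal := G.tree.Terminal

noncomputable instance : Fintype G.Terminal :=
  have := GameTree.finite_terminal G.finite_act G.tree
  Fintype.ofFinite _

/-- The tree-form decision problem faced by player `i`: its decision points are the infosets, and
the path to an infoset consists of the player's own moves on the way to any node of it. -/
noncomputable def decisionProblem (i : ι) : DecisionProblem where
  J := G.Infoset i
  A := G.Act i
  finite_action := G.finite_act i
  nonempty_action := G.nonempty_act i
  path j := ownMoves i (G.infoset_nonempty i j).choose
  path_of_path_eq := by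
    intro j l m hl
    obtain ⟨_, h⟩ := (G.infoset_nonempty i j).choose_spec
    obtain ⟨L', child, h1, h2⟩ := h.exists_of_ownMoves i l m hl
    obtain ⟨_, h'⟩ := (G.infoset_nonempty i m.1).choose_spec
    exact (G.perfect_recall i m.1 _ _ _ _ h' h1).trans h2

/-- The last observation point of player `i` on the path to a terminal node. -/
noncomputable def lastSeq (i : ι) (z : G.Terminal) : (G.decisionProblem i).Seq :=
  (ownMoves i (G.tree.moves z)).getLast?

variable [Fintype ι]

/-- The probability of reaching a terminal node under a profile of sequence-form strategies. -/
noncomputable def reachProb (x : ∀ i, (G.decisionProblem i).Seq → ℝ) (z : G.Terminal) : ℝ :=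
  G.tree.chanceProb z * ∏ i, x i (G.lastSeq i z)

/-- The expected utility of player `i` under a profile of sequence-form strategies. -/
noncomputable def expUtility (i : ι) (x : ∀ i, (G.decisionProblem i).Seq → ℝ) : ℝ :=
  ∑ z, G.reachProb x z * G.utility i z

variable {S : ι → Type*} {H : ι → ℕ}

/-- The distribution over terminal nodes when mediators `M` are drawn from `π` and the players
use `φ i (M i)`. -/
noncomputable def outcome (π : PMF (∀ i, Mediator (S i) (H i)))
    (φ : ∀ i, Mediator (S i) (H i) → (G.decisionProblem i).Seq → ℝ) (z : G.Terminal) : ℝ :=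
  pmfExpect π fun M => G.reachProb (fun i => φ i (M i)) z

open Classical in
/-- `(π, φ)` is an untimed private communication equilibrium: every `φ i` is an untimed interaction,
and no player can profit by switching to another untimed interaction. -/
def IsUntimedEquilibrium (π : PMF (∀ i, Mediator (S i) (H i)))
    (φ : ∀ i, Mediator (S i) (H i) → (G.decisionProblem i).Seq → ℝ) : Prop :=
  (∀ i, φ i ∈ untimedInteractions (G.decisionProblem i) (S i) (H i)) ∧
  ∀ i, ∀ φ' ∈ untimedInteractions (G.decisionProblem i) (S i) (H i),
    pmfExpect π (fun M => G.expUtility i (fun k => Function.update φ i φ' k (M k)) -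
      G.expUtility i (fun k => φ k (M k))) ≤ 0

/-- `(π, φ)` is direct: `π` is a distribution over profiles of direct mediators, and `φ i` maps the
direct mediator of each pure strategy `x` to `x`. -/
def IsDirect (e : ∀ i, (G.decisionProblem i).BasicMessage ↪ S i)
    (π : PMF (∀ i, Mediator (S i) (H i)))
    (φ : ∀ i, Mediator (S i) (H i) → (G.decisionProblem i).Seq → ℝ) : Prop :=
  (∀ M ∈ π.support, ∀ i, ∃ x ∈ (G.decisionProblem i).pureStrategies,
    M i = (G.decisionProblem i).directMediator (e i) (H i) x) ∧
  ∀ i, ∀ x ∈ (G.decisionProblem i).pureStrategies,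
    φ i ((G.decisionProblem i).directMediator (e i) (H i) x) = x

end ExtensiveFormGame

/-!
Sample the mediators `M` from `π` and, independently, pure strategies `f i` from the mixed
strategies behind `φ i`. Playing `f i` against `M i` amounts to a pure strategy of the decision
problem, and the new equilibrium hands player `i` the direct mediator of that pure strategy;
reporting every decision point and obeying the recommendation then reproduces the old outcome.

A deviation `f'` against the direct mediator is also available against `M i`: the player simulates
the direct mediator by running `f i` against `M i`, and reads the next recommendation off that run
whenever the messages of `f'` spell out the path to a decision point. Because the reports need not
be made when the real decision points are reached, this uses that an untimed player may send any
number of messages at each of them. The simulated conversation is not lost between decision points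
although a strategy sees only the actual message history: it can be replayed from that history.
Every profitable deviation from the new profile thus gives one from the old profile.
-/

/-! ### Expectations and product distributions -/

section Expectation

variable {α β : Type*}

theorem summable_pmf_toReal (p : PMF α) : Summable fun a => (p a).toReal :=
  ENNReal.summable_toReal p.tsum_coe_ne_top

theorem tsum_pmf_toReal (p : PMF α) : ∑' a, (p a).toReal = 1 := by
  rw [← ENNReal.tsum_toReal_eq p.apply_ne_top, p.tsum_coe, ENNReal.toReal_one]

theorem abs_pmf_toReal_mul_le (p : PMF α) {f : α → ℝ} {C : ℝ} (hf : ∀ a, |f a| ≤ C) (a : α) :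
    |(p a).toReal * f a| ≤ (p a).toReal * C := by
  rw [abs_mul, abs_of_nonneg ENNReal.toReal_nonneg]
  exact mul_le_mul_of_nonneg_left (hf a) ENNReal.toReal_nonneg

theorem summable_pmf_toReal_mul (p : PMF α) {f : α → ℝ} {C : ℝ} (hf : ∀ a, |f a| ≤ C) :
    Summable fun a => (p a).toReal * f a :=
  .of_norm_bounded ((summable_pmf_toReal p).mul_right C) (abs_pmf_toReal_mul_le p hf)

theorem abs_pmfExpect_le (p : PMF α) {f : α → ℝ} {C : ℝ} (hf : ∀ a, |f a| ≤ C) :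
    |pmfExpect p f| ≤ C :=
  calc ‖∑' a, (p a).toReal * f a‖ ≤ ∑' a, (p a).toReal * C :=
        tsum_of_norm_bounded ((summable_pmf_toReal p).mul_right C).hasSum
          (abs_pmf_toReal_mul_le p hf)
    _ = C := by rw [tsum_mul_right, tsum_pmf_toReal, one_mul]

theorem pmfExpect_mul_left (p : PMF α) (c : ℝ) (f : α → ℝ) :
    pmfExpect p (fun a => c * f a) = c * pmfExpect p f := by
  simp only [pmfExpect, ← tsum_mul_left, mul_left_comm]

theorem pmfExpect_mul_right (p : PMF α) (f : α → ℝ) (c : ℝ) :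
    pmfExpect p (fun a => f a * c) = pmfExpect p f * c := by
  simp only [pmfExpect, ← tsum_mul_right, mul_assoc]

theorem pmfExpect_pure (a : α) (f : α → ℝ) : pmfExpect (PMF.pure a) f = f a := by
  rw [pmfExpect, tsum_eq_single a fun b hb => by simp [hb]]
  simp

theorem pmfExpect_bind (p : PMF α) (q : α → PMF β) {f : β → ℝ} {C : ℝ} (hf : ∀ b, |f b| ≤ C) :
    pmfExpect (p.bind q) f = pmfExpect p fun a => pmfExpect (q a) f := by
  have joint_mass : ∑' x : α × β, p x.1 * q x.1 x.2 ≠ ⊤ := by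
    simp [ENNReal.tsum_prod', ENNReal.tsum_mul_left]
  have summable_joint : Summable (Function.uncurry fun a b =>
      (p a).toReal * ((q a b).toReal * f b)) := by
    refine .of_norm_bounded ((ENNReal.summable_toReal joint_mass).mul_right C) fun x => ?_
    rw [Function.uncurry, ← mul_assoc, ← ENNReal.toReal_mul, norm_mul, Real.norm_eq_abs,
      abs_of_nonneg ENNReal.toReal_nonneg]
    exact mul_le_mul_of_nonneg_left (hf x.2) ENNReal.toReal_nonneg
  have bind_apply_mul (b : β) :
      ((p.bind q) b).toReal * f b = ∑' a, (p a).toReal * ((q a b).toReal * f b) := by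
    rw [PMF.bind_apply, ENNReal.tsum_toReal_eq fun a =>
      ENNReal.mul_ne_top (p.apply_ne_top a) ((q a).apply_ne_top b), ← tsum_mul_right]
    simp only [ENNReal.toReal_mul, mul_assoc]
  simp only [pmfExpect, bind_apply_mul, ← tsum_mul_left]
  exact summable_joint.tsum_comm

theorem pmfExpect_map (p : PMF α) (g : α → β) {f : β → ℝ} {C : ℝ} (hf : ∀ b, |f b| ≤ C) :
    pmfExpect (p.map g) f = pmfExpect p fun a => f (g a) := by
  rw [← PMF.bind_pure_comp, pmfExpect_bind p _ hf]
  simp only [Function.comp_apply, pmfExpect_pure]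

end Expectation

section ProductDistribution

variable {ι : Type*} {α : ι → Type*}

theorem abs_prod_le_prod (s : Finset ι) {x C : ι → ℝ} (hx : ∀ i, |x i| ≤ C i) :
    |∏ i ∈ s, x i| ≤ ∏ i ∈ s, C i := by
  rw [Finset.abs_prod]
  exact Finset.prod_le_prod (fun _ _ => abs_nonneg _) fun i _ => hx i

open Classical in
/-- The distribution of a family whose coordinates listed in `l` are drawn independently, coordinate
`i` from `μ i`. The other coordinates are fixed arbitrarily. -/
noncomputable def drawCoordinates (μ : ∀ i, PMF (α i)) : List ι → PMF (∀ i, α i)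
  | [] => PMF.pure fun i => (μ i).support_nonempty.some
  | i :: l => (drawCoordinates μ l).bind fun f => (μ i).map (Function.update f i)

open Classical in
theorem pmfExpect_drawCoordinates (μ : ∀ i, PMF (α i)) {g : ∀ i, α i → ℝ} {C : ι → ℝ}
    (hg : ∀ i a, |g i a| ≤ C i) {l : List ι} (hl : l.Nodup) :
    pmfExpect (drawCoordinates μ l) (fun f => ∏ i ∈ l.toFinset, g i (f i)) =
      ∏ i ∈ l.toFinset, pmfExpect (μ i) (g i) := by
  induction l with
  | nil => simp [drawCoordinates, pmfExpect_pure]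
  | cons i l ih =>
    obtain ⟨hi, hl⟩ := List.nodup_cons.1 hl
    replace hi : i ∉ l.toFinset := by rwa [List.mem_toFinset]
    have bounded (f : ∀ i, α i) : |∏ k ∈ insert i l.toFinset, g k (f k)| ≤
        ∏ k ∈ insert i l.toFinset, C k := abs_prod_le_prod _ fun k => hg k _
    have prod_update (f : ∀ i, α i) (a : α i) :
        ∏ k ∈ insert i l.toFinset, g k (Function.update f i a k) =
          g i a * ∏ k ∈ l.toFinset, g k (f k) := by
      rw [Finset.prod_insert hi, Function.update_self]
      exact congrArg _ (Finset.prod_congr rfl fun k hk => by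
        rw [Function.update_of_ne (ne_of_mem_of_not_mem hk hi)])
    rw [List.toFinset_cons, Finset.prod_insert hi, drawCoordinates, pmfExpect_bind _ _ bounded]
    simp only [pmfExpect_map _ _ bounded, prod_update, pmfExpect_mul_right, pmfExpect_mul_left,
      ih hl]

/-- The product of finitely many discrete probability distributions. -/
noncomputable def productPMF [Fintype ι] (μ : ∀ i, PMF (α i)) : PMF (∀ i, α i) :=
  drawCoordinates μ Finset.univ.toList

theorem pmfExpect_productPMF [Fintype ι] (μ : ∀ i, PMF (α i)) {g : ∀ i, α i → ℝ} {C : ι → ℝ}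
    (hg : ∀ i a, |g i a| ≤ C i) :
    pmfExpect (productPMF μ) (fun f => ∏ i, g i (f i)) = ∏ i, pmfExpect (μ i) (g i) := by
  classical
  simpa only [productPMF, Finset.toList_toFinset] using
    pmfExpect_drawCoordinates μ hg Finset.univ.nodup_toList

end ProductDistribution

/-! ### Decision problems and direct mediators -/

namespace DecisionProblem

variable {D : DecisionProblem}

theorem path_induction {P : List (Σ j, D.A j) → Prop} (nil : P [])
    (append_singleton : ∀ m : Σ j, D.A j, P (D.path m.1) → P (D.path m.1 ++ [m])) (j : D.J) :
    P (D.path j) := by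
  induction hl : D.path j using List.reverseRecOn generalizing j with
  | nil => exact nil
  | append_singleton l m ih =>
    obtain rfl : D.path m.1 = l := D.path_of_path_eq j l m hl
    exact append_singleton m (ih m.1 rfl)

theorem seqPath_induction {P : List (Σ j, D.A j) → Prop} (nil : P [])
    (append_singleton : ∀ m : Σ j, D.A j, P (D.path m.1) → P (D.path m.1 ++ [m])) :
    ∀ σ : D.Seq, P (D.seqPath σ)
  | none => nil
  | some m => append_singleton m (path_induction nil append_singleton m.1)

/-- The choice `s` of one action at every decision point leads to the decision point `j`. -/
def Reaches (s : ∀ j, D.A j) (j : D.J) : Prop := ∀ m ∈ D.path j, s m.1 = m.2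

theorem seqForm_congr_of_reaches {s t : ∀ j, D.A j} (h : ∀ j, Reaches s j → t j = s j) :
    D.seqForm t = D.seqForm s := by
  classical
  have follows_iff (σ : D.Seq) :
      (∀ m ∈ D.seqPath σ, t m.1 = m.2) ↔ ∀ m ∈ D.seqPath σ, s m.1 = m.2 := by
    refine seqPath_induction (P := fun l => (∀ m ∈ l, t m.1 = m.2) ↔ ∀ m ∈ l, s m.1 = m.2)
      (by simp) (fun m ih => ?_) σ
    simp only [List.forall_mem_append, List.forall_mem_singleton, ih]
    exact and_congr_right fun hs => by rw [h m.1 hs]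
  exact funext fun σ => if_congr (follows_iff σ) rfl rfl

theorem abs_seqForm_le_one (D : DecisionProblem) (s : ∀ j, D.A j) (σ : D.Seq) :
    |D.seqForm s σ| ≤ 1 := by
  rw [seqForm]
  split_ifs <;> simp

theorem seqForm_some_eq_one {s : ∀ j, D.A j} {m : Σ j, D.A j} :
    D.seqForm s (some m) = 1 ↔ Reaches s m.1 ∧ s m.1 = m.2 := by
  classical
  rw [seqForm, ite_eq_left_iff]
  simp [seqPath, or_imp, forall_and, Reaches]

variable {S : Type*} (e : D.BasicMessage ↪ S)

/-- The messages `(j₁, a₁, j₂, a₂, …)` exchanged with a direct mediator along a list of moves. -/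
def moveMessages (l : List (Σ j, D.A j)) : List S :=
  l.flatMap fun m => [e (.inl m.1), e (.inr (.inl (some m)))]

theorem pathMessages_eq (j : D.J) :
    D.pathMessages e j = moveMessages e (D.path j) ++ [e (.inl j)] := rfl

theorem moveMessages_append_singleton (l : List (Σ j, D.A j)) (m : Σ j, D.A j) :
    moveMessages e (l ++ [m]) =
      (moveMessages e l ++ [e (.inl m.1)]) ++ [e (.inr (.inl (some m)))] := by
  simp [moveMessages]

theorem moveMessages_path_append (j : D.J) (a : D.A j) :
    moveMessages e (D.path j ++ [⟨j, a⟩]) =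
      D.pathMessages e j ++ [e (.inr (.inl (some ⟨j, a⟩)))] :=
  moveMessages_append_singleton e _ _

theorem length_moveMessages (l : List (Σ j, D.A j)) :
    (moveMessages e l).length = 2 * l.length := by
  simp [moveMessages, mul_comm]

theorem length_pathMessages (j : D.J) : (D.pathMessages e j).length = D.depth j := by
  rw [pathMessages_eq, List.length_append, length_moveMessages, List.length_singleton, depth]

theorem moveMessages_injective : Function.Injective (moveMessages e) := by
  intro l l' h
  induction l generalizing l' with
  | nil => cases l' with
    | nil => rfl
    | cons m' l' => simp [moveMessages] at h
  | cons m l ih => cases l' with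
    | nil => simp [moveMessages] at h
    | cons m' l' =>
      simp only [moveMessages, List.flatMap_cons, List.cons_append, List.nil_append,
        List.cons.injEq, EmbeddingLike.apply_eq_iff_eq, Sum.inr.injEq, Sum.inl.injEq,
        Option.some.injEq] at h
      rw [h.2.1, ih h.2.2]

theorem pathMessages_injective : Function.Injective (D.pathMessages e) := by
  intro j j' h
  simpa using (List.append_inj' h rfl).2

variable {H : ℕ}

theorem directMediator_pathMessages {s : ∀ j, D.A j} {j : D.J} (hs : Reaches s j)
    (hH : (D.pathMessages e j).length ≤ H) :
    D.directMediator e H (D.seqForm s) ⟨D.pathMessages e j, hH⟩ =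
      e (.inr (.inl (some ⟨j, s j⟩))) := by
  have recommends : ∃ m : Σ j, D.A j, D.pathMessages e j = D.pathMessages e m.1 ∧
      D.seqForm s (some m) = 1 := ⟨⟨j, s j⟩, rfl, seqForm_some_eq_one.2 ⟨hs, rfl⟩⟩
  have unique : ∀ m : Σ j, D.A j, D.pathMessages e j = D.pathMessages e m.1 ∧
      D.seqForm s (some m) = 1 → m = ⟨j, s j⟩ := by
    rintro ⟨k, a⟩ ⟨hk, ha⟩
    obtain rfl : j = k := pathMessages_injective e hk
    obtain rfl : s j = a := (seqForm_some_eq_one.1 ha).2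
    rfl
  rw [directMediator, dif_pos recommends, unique _ recommends.choose_spec]

theorem directMediator_of_forall_ne (x : D.Seq → ℝ) (h : {s : List S // s.length ≤ H})
    (hh : ∀ j, h.1 ≠ D.pathMessages e j) :
    D.directMediator e H x h = e (.inr (.inr ())) :=
  dif_neg fun ⟨_, hm, _⟩ => hh _ hm

end DecisionProblem

/-! ### Untimed strategies -/

namespace UntimedStrategy

open DecisionProblem

variable {D : DecisionProblem} {S : Type*} {H : ℕ}

section Act

variable {f : UntimedStrategy D S H} {j : D.J} {h : List S}

theorem act_of_inl {a : D.A j} (hf : f j h = .inl a) (M : Mediator S H) :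
    f.act M j h = (a, h) := by
  rw [act, hf]

theorem act_of_inr {m : S} {hm : h.length < H} (hf : f j h = .inr ⟨m, hm⟩) (M : Mediator S H) :
    f.act M j h = f.act M j ((h ++ [m]) ++ [M ⟨h ++ [m], by simp; omega⟩]) := by
  rw [act, hf]

/-- The last exchange may start at length `H - 1` and ends with a reply: hence `H + 1`. -/
theorem length_act_le (f : UntimedStrategy D S H) (M : Mediator S H) (j : D.J) {h : List S}
    (hh : h.length ≤ H + 1) : (f.act M j h).2.length ≤ H + 1 := by
  match hf : f j h with
  | .inl a => rwa [act_of_inl hf]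
  | .inr ⟨m, hm⟩ =>
    rw [act_of_inr hf]
    exact f.length_act_le M j (by simp; omega)
termination_by H - h.length
decreasing_by simp; omega

end Act

/-- The message history after the decision points of the moves in `l` have been dealt with, starting
from the message history `h`. -/
def history (f : UntimedStrategy D S H) (M : Mediator S H) (l : List (Σ j, D.A j))
    (h : List S) : List S :=
  l.foldl (fun h m => (f.act M m.1 h).2) h

theorem history_append_singleton (f : UntimedStrategy D S H) (M : Mediator S H)
    (l : List (Σ j, D.A j)) (m : Σ j, D.A j) (h : List S) :
    f.history M (l ++ [m]) h = (f.act M m.1 (f.history M l h)).2 := by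
  simp [history]

theorem plays_append_singleton (f : UntimedStrategy D S H) (M : Mediator S H)
    (l : List (Σ j, D.A j)) (m : Σ j, D.A j) (h : List S) :
    f.Plays M (l ++ [m]) h ↔ f.Plays M l h ∧ (f.act M m.1 (f.history M l h)).1 = m.2 := by
  induction l generalizing h with
  | nil => simp [Plays, history]
  | cons m' l ih => simp [Plays, history, and_assoc, ih]

/-- The message history with which `f`, interacting with `M`, arrives at `j`. -/
def arrival (f : UntimedStrategy D S H) (M : Mediator S H) (j : D.J) : List S :=
  f.history M (D.path j) []

/-- The reduced strategy to which `f` amounts when it interacts with `M`: the action that is played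
at each decision point if it is reached. -/
def playOf (f : UntimedStrategy D S H) (M : Mediator S H) (j : D.J) : D.A j :=
  (f.act M j (f.arrival M j)).1

theorem plays_seqPath_iff (f : UntimedStrategy D S H) (M : Mediator S H) (σ : D.Seq) :
    f.Plays M (D.seqPath σ) [] ↔ ∀ m ∈ D.seqPath σ, f.playOf M m.1 = m.2 := by
  refine seqPath_induction (P := fun l => f.Plays M l [] ↔ ∀ m ∈ l, f.playOf M m.1 = m.2)
    (by simp [Plays]) (fun m ih => ?_) σ
  rw [plays_append_singleton, ih, List.forall_mem_append, List.forall_mem_singleton]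
  rfl

open Classical in
theorem seqForm_playOf (f : UntimedStrategy D S H) (M : Mediator S H) (σ : D.Seq) :
    D.seqForm (f.playOf M) σ = if f.Plays M (D.seqPath σ) [] then 1 else 0 :=
  if_congr (f.plays_seqPath_iff M σ).symm rfl rfl

section Direct

variable (e : D.BasicMessage ↪ S)

open Classical in
/-- The strategy of an honest and obedient player: report the decision point and play the action
that is recommended. It plays an arbitrary action when no report is possible. -/
noncomputable def direct (H : ℕ) : UntimedStrategy D S H := fun j h =>
  if ha : ∃ a : D.A j, h = moveMessages e (D.path j ++ [⟨j, a⟩]) then .inl ha.choose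
  else if hH : h.length < H then .inr ⟨e (.inl j), hH⟩
  else .inl (D.nonempty_action j).some

theorem direct_moveMessages_path {j : D.J} (hH : (moveMessages e (D.path j)).length < H) :
    direct e H j (moveMessages e (D.path j)) = .inr ⟨e (.inl j), hH⟩ := by
  rw [direct, dif_neg, dif_pos hH]
  rintro ⟨a, ha⟩
  simpa using moveMessages_injective e ha

theorem direct_moveMessages_path_append (j : D.J) (a : D.A j) :
    direct e H j (moveMessages e (D.path j ++ [⟨j, a⟩])) = .inl a := by
  have recommended : ∃ b : D.A j,
      moveMessages e (D.path j ++ [⟨j, a⟩]) = moveMessages e (D.path j ++ [⟨j, b⟩]) := ⟨a, rfl⟩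
  rw [direct, dif_pos recommended]
  simpa [eq_comm] using moveMessages_injective e recommended.choose_spec

theorem act_direct {s : ∀ j, D.A j} {j : D.J} (hH : D.depth j ≤ H) (hs : Reaches s j) :
    (direct e H).act (D.directMediator e H (D.seqForm s)) j (moveMessages e (D.path j)) =
      (s j, moveMessages e (D.path j ++ [⟨j, s j⟩])) := by
  have hlen : (moveMessages e (D.path j)).length < H := by
    rw [length_moveMessages]; rwa [depth] at hH
  have recommendation := directMediator_pathMessages e hs (hH.trans' (length_pathMessages e j).le)
  simp only [pathMessages_eq] at recommendation
  rw [act_of_inr (direct_moveMessages_path e hlen), recommendation,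
    ← moveMessages_append_singleton e (D.path j) ⟨j, s j⟩,
    act_of_inl (direct_moveMessages_path_append e j (s j))]

theorem arrival_direct (hH : ∀ j, D.depth j ≤ H) {s : ∀ j, D.A j} {j : D.J} (hs : Reaches s j) :
    (direct e H).arrival (D.directMediator e H (D.seqForm s)) j = moveMessages e (D.path j) := by
  refine path_induction (P := fun l => (∀ m ∈ l, s m.1 = m.2) →
    (direct e H).history (D.directMediator e H (D.seqForm s)) l [] = moveMessages e l)
    (fun _ => rfl) (fun m ih hm => ?_) j hs
  rw [List.forall_mem_append, List.forall_mem_singleton] at hm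
  rw [history_append_singleton, ih hm.1, act_direct e (hH m.1) hm.1, hm.2]

theorem seqForm_playOf_direct (hH : ∀ j, D.depth j ≤ H) (s : ∀ j, D.A j) :
    D.seqForm ((direct e H).playOf (D.directMediator e H (D.seqForm s))) = D.seqForm s :=
  seqForm_congr_of_reaches fun j hs => by
    rw [playOf, arrival_direct e hH hs, act_direct e (hH j) hs]

end Direct

end UntimedStrategy

/-! ### Dialogues and strategies with memory -/

/-- A program that sends messages, reads a reply to each, and finally returns a value. Unlike an
untimed strategy it does not depend on the messages exchanged before it was started. -/
inductive Dialogue (S : Type*) (α : Type*) where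
  | ret : α → Dialogue S α
  | send : S → (S → Dialogue S α) → Dialogue S α

namespace Dialogue

variable {S α β : Type*}

/-- The returned value and the final message history, when the dialogue starts with message history
`h` and the replies are given by `O`. -/
def run (O : List S → S) : Dialogue S α → List S → α × List S
  | ret a, h => (a, h)
  | send m k, h => (k (O (h ++ [m]))).run O ((h ++ [m]) ++ [O (h ++ [m])])

/-- Postprocessing of the returned value. -/
def map (g : α → β) : Dialogue S α → Dialogue S β
  | ret a => ret (g a)
  | send m k => send m fun r => (k r).map g

/-- Sequential composition. The second dialogue may depend on the value returned by the first and on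
the message history at that time, where the first dialogue starts with message history `h`. -/
def bind : Dialogue S α → List S → (α → List S → Dialogue S β) → Dialogue S β
  | ret a, h, Q => Q a h
  | send m k, h, Q => send m fun r => (k r).bind ((h ++ [m]) ++ [r]) Q

/-- The next message, or the returned value, after the messages and replies in the list. -/
def next : Dialogue S α → List S → S ⊕ α
  | ret a, _ => .inr a
  | send _ k, _ :: r :: h => (k r).next h
  | send m _, _ => .inl m

theorem run_map (O : List S → S) (g : α → β) (P : Dialogue S α) (h : List S) :
    (P.map g).run O h = (g (P.run O h).1, (P.run O h).2) := by
  induction P generalizing h with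
  | ret _ => rfl
  | send _ _ ih => exact ih _ _

theorem run_bind (O : List S → S) (P : Dialogue S α) (Q : α → List S → Dialogue S β)
    (h : List S) :
    (P.bind h Q).run O h = (Q (P.run O h).1 (P.run O h).2).run O (P.run O h).2 := by
  induction P generalizing h with
  | ret _ => rfl
  | send _ _ ih => exact ih _ _

theorem prefix_run (O : List S → S) (P : Dialogue S α) (h : List S) : h <+: (P.run O h).2 := by
  induction P generalizing h with
  | ret _ => exact List.prefix_rfl
  | send _ _ ih =>
    exact ((List.prefix_append _ _).trans (List.prefix_append _ _)).trans (ih _ _)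

theorem next_bind_append (O : List S → S) (P : Dialogue S α) (Q : α → List S → Dialogue S β)
    {h t : List S} (ht : (P.run O h).2 = h ++ t) (t' : List S) :
    (P.bind h Q).next (t ++ t') = (Q (P.run O h).1 (P.run O h).2).next t' := by
  induction P generalizing h t with
  | ret _ =>
    obtain rfl : t = [] := by simpa [run] using ht
    rfl
  | send m k ih =>
    obtain ⟨t₁, ht₁⟩ := (k (O (h ++ [m]))).prefix_run O ((h ++ [m]) ++ [O (h ++ [m])])
    obtain rfl : m :: O (h ++ [m]) :: t₁ = t := by
      rw [run, ← ht₁] at ht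
      simpa using ht
    exact ih _ ht₁.symm

end Dialogue

/-- A mediator as a function on all message histories, the long ones being truncated. -/
def Mediator.extend {S : Type*} {H : ℕ} (M : Mediator S H) (s : List S) : S :=
  M ⟨s.take H, by simp⟩

theorem Mediator.extend_of_le {S : Type*} {H : ℕ} (M : Mediator S H) {s : List S}
    (hs : s.length ≤ H) : M.extend s = M ⟨s, hs⟩ := by
  simp only [Mediator.extend, List.take_of_length_le hs]

namespace UntimedStrategy

variable {D : DecisionProblem} {S : Type*} {H : ℕ}

/-- The strategy that carries on with the dialogue `P j` from the beginning of the game, as far as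
the horizon permits: the part before the arrival at `j` is read off the message history. -/
noncomputable def ofDialogue (P : ∀ j, Dialogue S (D.A j)) : UntimedStrategy D S H := fun j h =>
  match (P j).next h with
  | .inr a => .inl a
  | .inl m => if hl : h.length < H then .inr ⟨m, hl⟩ else .inl (D.nonempty_action j).some

theorem act_ofDialogue (P : ∀ j, Dialogue S (D.A j)) (M : Mediator S H) {j : D.J}
    {Q : Dialogue S (D.A j)} {h : List S} (hQ : ∀ t, (P j).next (h ++ t) = Q.next t)
    (hlen : (Q.run M.extend h).2.length ≤ H + 1) :
    (ofDialogue (H := H) P).act M j h = Q.run M.extend h := by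
  induction Q generalizing h with
  | ret a =>
    have next_eq : (P j).next h = .inr a := by simpa [Dialogue.next] using hQ []
    exact act_of_inl (by rw [ofDialogue, next_eq]) M
  | send m k ih =>
    have next_eq : (P j).next h = .inl m := by simpa [Dialogue.next] using hQ []
    rw [Dialogue.run] at hlen ⊢
    have hl : h.length < H := by
      have := (Dialogue.prefix_run _ _ _).length_le.trans hlen
      simp only [List.length_append, List.length_singleton] at this
      omega
    have sends : ofDialogue (H := H) P j h = .inr ⟨m, hl⟩ := by
      rw [ofDialogue, next_eq]
      exact dif_pos hl
    have hl' : (h ++ [m]).length ≤ H := by simpa using hl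
    rw [act_of_inr sends M]
    rw [M.extend_of_le hl'] at hlen ⊢
    refine ih _ (fun t => ?_) hlen
    simpa [Dialogue.next] using hQ (m :: M ⟨h ++ [m], hl'⟩ :: t)

/-- The dialogue of `f` at `j`, when `j` is reached with message history `h`. -/
def toDialogue (f : UntimedStrategy D S H) (j : D.J) (h : List S) : Dialogue S (D.A j) :=
  match f j h with
  | .inl a => .ret a
  | .inr ⟨m, _⟩ => .send m fun r => f.toDialogue j ((h ++ [m]) ++ [r])
termination_by H - h.length
decreasing_by simp; omega

theorem run_toDialogue (f : UntimedStrategy D S H) (M : Mediator S H) (j : D.J) (h : List S) :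
    (f.toDialogue j h).run M.extend h = f.act M j h := by
  match hf : f j h with
  | .inl a => rw [toDialogue, act_of_inl hf, hf, Dialogue.run]
  | .inr ⟨m, hm⟩ =>
    rw [toDialogue, act_of_inr hf, hf, Dialogue.run, M.extend_of_le (by simpa using hm)]
    exact f.run_toDialogue M j _
termination_by H - h.length
decreasing_by simp; omega

end UntimedStrategy

/-- A strategy with a private memory of type `σ`: the dialogue `step j x h` is carried out at `j`
when it is reached with memory `x` and message history `h`, and returns the action to be played and
the new memory. -/
structure MemoryStrategy (D : DecisionProblem) (S σ : Type*) where
  initial : σ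
  step : ∀ j, σ → List S → Dialogue S (D.A j × σ)

namespace MemoryStrategy

variable {D : DecisionProblem} {S σ : Type*} {H : ℕ} (g : MemoryStrategy D S σ)

/-- The dialogue carried out at the decision points of the given moves, from the beginning of the
game. It returns the memory. -/
def along (l : List (Σ j, D.A j)) : Dialogue S σ :=
  l.foldl (fun P m => P.bind [] fun x h => (g.step m.1 x h).map Prod.snd) (.ret g.initial)

/-- The action played at `j` and the memory and message history thereafter, if `j` is reached and
the replies are given by `O`. -/
def visit (O : List S → S) (j : D.J) : (D.A j × σ) × List S :=
  (g.step j ((g.along (D.path j)).run O []).1 ((g.along (D.path j)).run O []).2).run O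
    ((g.along (D.path j)).run O []).2

theorem run_along_path_append (O : List S → S) (m : Σ j, D.A j) :
    (g.along (D.path m.1 ++ [m])).run O [] = ((g.visit O m.1).1.2, (g.visit O m.1).2) := by
  rw [along, List.foldl_append, List.foldl_cons, List.foldl_nil, Dialogue.run_bind,
    Dialogue.run_map]
  rfl

/-- The strategy without private memory that recovers the memory by replaying the earlier dialogues
from the message history. -/
noncomputable def toUntimed (H : ℕ) : UntimedStrategy D S H :=
  .ofDialogue fun j => (g.along (D.path j)).bind [] fun x h => (g.step j x h).map Prod.fst

variable {M : Mediator S H}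

theorem act_toUntimed {j : D.J} (hlen : (g.visit M.extend j).2.length ≤ H + 1) :
    (g.toUntimed H).act M j ((g.along (D.path j)).run M.extend []).2 =
      ((g.visit M.extend j).1.1, (g.visit M.extend j).2) := by
  rw [visit, ← Dialogue.run_map]
  refine UntimedStrategy.act_ofDialogue _ M (fun t => ?_) (by rwa [Dialogue.run_map])
  exact Dialogue.next_bind_append M.extend _ _ (List.nil_append _).symm t

variable (hlen : ∀ j, (g.visit M.extend j).2.length ≤ H + 1)
include hlen

theorem arrival_toUntimed (j : D.J) :
    (g.toUntimed H).arrival M j = ((g.along (D.path j)).run M.extend []).2 := by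
  refine DecisionProblem.path_induction
    (P := fun l => (g.toUntimed H).history M l [] = ((g.along l).run M.extend []).2)
    rfl (fun m ih => ?_) j
  rw [UntimedStrategy.history_append_singleton, ih, g.act_toUntimed (hlen m.1),
    run_along_path_append]

theorem playOf_toUntimed (j : D.J) : (g.toUntimed H).playOf M j = (g.visit M.extend j).1.1 := by
  rw [UntimedStrategy.playOf, g.arrival_toUntimed hlen, g.act_toUntimed (hlen j)]

end MemoryStrategy

/-! ### Simulation of a direct mediator -/

namespace UntimedStrategy

open DecisionProblem

variable {D : DecisionProblem} {S : Type*} {H : ℕ} (e : D.BasicMessage ↪ S)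
  (f f' : UntimedStrategy D S H) (M : Mediator S H)

/-- The direct mediator of the pure strategy to which `f` amounts when it interacts with `M`. -/
noncomputable def inducedMediator : Mediator S H := D.directMediator e H (D.seqForm (f.playOf M))

open Classical in
/-- The dialogue that computes the reply of the induced mediator to `s`, when the actual message
history is `h`: if `s` is the path to a decision point `k`, the recommendation is found by letting
`f` act at `k`. -/
noncomputable def simulateReply (s h : List S) : Dialogue S S :=
  if hk : ∃ k, s = D.pathMessages e k then
    (f.toDialogue hk.choose h).map fun a => e (.inr (.inl (some ⟨hk.choose, a⟩)))
  else .ret (e (.inr (.inr ())))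

/-- The dialogue of `f'` at `j` with a simulated induced mediator, when `h'` is the simulated and
`h` the actual message history. It returns the action to be played and the new simulated history. -/
noncomputable def simulateAct (j : D.J) (h' h : List S) : Dialogue S (D.A j × List S) :=
  match f' j h' with
  | .inl a => .ret (a, h')
  | .inr ⟨m, _⟩ => (f.simulateReply e (h' ++ [m]) h).bind h fun r h₁ =>
      simulateAct j ((h' ++ [m]) ++ [r]) h₁
termination_by H - h'.length
decreasing_by simp; omega

/-- The invariant of the simulation, for the simulated history `h'` and the actual history `h`: when
`h'` leads to a decision point, `f` has arrived there with history `h`. The length bound makes sure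
that the horizon does not cut off the simulation. -/
def Consistent (h' h : List S) : Prop :=
  h.length ≤ H + 1 ∧
    ∀ k, h' = moveMessages e (D.path k) → Reaches (f.playOf M) k ∧ h = f.arrival M k

variable {e f M}

theorem Consistent.run_simulateReply_pathMessages {h : List S} {k : D.J}
    (hc : f.Consistent e M (moveMessages e (D.path k)) h)
    (hl : (D.pathMessages e k).length ≤ H) :
    (f.simulateReply e (D.pathMessages e k) h).run M.extend h =
      (f.inducedMediator e M ⟨D.pathMessages e k, hl⟩, (f.act M k h).2) := by
  obtain ⟨hs, rfl⟩ := hc.2 k rfl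
  have hk : ∃ k', D.pathMessages e k = D.pathMessages e k' := ⟨k, rfl⟩
  have choose_eq : hk.choose = k := (pathMessages_injective e hk.choose_spec).symm
  rw [simulateReply, dif_pos hk, choose_eq, Dialogue.run_map, run_toDialogue, inducedMediator,
    directMediator_pathMessages e hs]
  rfl

theorem Consistent.append_recommendation {h : List S} {k : D.J}
    (hc : f.Consistent e M (moveMessages e (D.path k)) h) :
    f.Consistent e M (D.pathMessages e k ++ [e (.inr (.inl (some ⟨k, f.playOf M k⟩)))])
      (f.act M k h).2 := by
  obtain ⟨hs, rfl⟩ := hc.2 k rfl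
  refine ⟨f.length_act_le M k hc.1, fun k' hk' => ?_⟩
  have path_eq : D.path k ++ [⟨k, f.playOf M k⟩] = D.path k' :=
    moveMessages_injective e (by rw [moveMessages_path_append, hk'])
  have arrival_eq : (f.act M k (f.arrival M k)).2 = f.arrival M k' := by
    rw [arrival, arrival, ← path_eq, history_append_singleton]
  refine ⟨?_, arrival_eq⟩
  rw [Reaches, ← path_eq, List.forall_mem_append, List.forall_mem_singleton]
  exact ⟨hs, rfl⟩

theorem Consistent.append_null {h' h : List S} (hc : f.Consistent e M h' h) (s : List S) :
    f.Consistent e M (s ++ [e (.inr (.inr ()))]) h := by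
  refine ⟨hc.1, fun k hk => ?_⟩
  rcases List.eq_nil_or_concat (D.path k) with hnil | ⟨l, m, hm⟩
  · simp [hnil, moveMessages] at hk
  · rw [hm, List.concat_eq_append, moveMessages_append_singleton] at hk
    simpa using (List.append_inj' hk rfl).2

theorem Consistent.run_simulateReply {h' h : List S} (hc : f.Consistent e M h' h) {m : S}
    (hl : (h' ++ [m]).length ≤ H) :
    ∃ h₁, (f.simulateReply e (h' ++ [m]) h).run M.extend h =
        (f.inducedMediator e M ⟨h' ++ [m], hl⟩, h₁) ∧
      f.Consistent e M ((h' ++ [m]) ++ [f.inducedMediator e M ⟨h' ++ [m], hl⟩]) h₁ := by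
  by_cases hk : ∃ k, h' ++ [m] = D.pathMessages e k
  · obtain ⟨k, hk⟩ := hk
    obtain rfl : h' = moveMessages e (D.path k) := (List.append_inj' hk rfl).1
    simp only [hk] at hl ⊢
    refine ⟨_, hc.run_simulateReply_pathMessages hl, ?_⟩
    rw [inducedMediator, directMediator_pathMessages e (hc.2 k rfl).1]
    exact hc.append_recommendation
  · have reply : f.inducedMediator e M ⟨h' ++ [m], hl⟩ = e (.inr (.inr ())) :=
      directMediator_of_forall_ne e _ _ fun k h => hk ⟨k, h⟩
    rw [simulateReply, dif_neg hk, reply]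
    exact ⟨h, rfl, hc.append_null _⟩

theorem Consistent.run_simulateAct {h' h : List S} (hc : f.Consistent e M h' h) (j : D.J) :
    ∃ h₁, (f.simulateAct e f' j h' h).run M.extend h =
        (f'.act (f.inducedMediator e M) j h', h₁) ∧
      f.Consistent e M (f'.act (f.inducedMediator e M) j h').2 h₁ := by
  match hf : f' j h' with
  | .inl a =>
    rw [simulateAct, act_of_inl hf, hf]
    exact ⟨h, rfl, hc⟩
  | .inr ⟨m, hm⟩ =>
    obtain ⟨h₁, hrun, hc₁⟩ := hc.run_simulateReply (m := m) (by simpa using hm)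
    rw [simulateAct, act_of_inr hf, hf, Dialogue.run_bind, hrun]
    exact hc₁.run_simulateAct j
termination_by H - h'.length
decreasing_by simp; omega

theorem consistent_nil : f.Consistent e M [] [] := by
  refine ⟨Nat.zero_le _, fun k hk => ?_⟩
  have path_eq : [] = D.path k := moveMessages_injective e hk
  simp [Reaches, arrival, ← path_eq, history]

variable (e f)

/-- The strategy `f'` with a simulated induced mediator; the memory is the simulated history. -/
noncomputable def simulation : MemoryStrategy D S (List S) where
  initial := []
  step := f.simulateAct e f'

variable (M)

theorem run_simulation_along (j : D.J) :
    ∃ h, ((f.simulation e f').along (D.path j)).run M.extend [] =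
        (f'.arrival (f.inducedMediator e M) j, h) ∧
      f.Consistent e M (f'.arrival (f.inducedMediator e M) j) h := by
  refine path_induction (P := fun l => ∃ h, ((f.simulation e f').along l).run M.extend [] =
      (f'.history (f.inducedMediator e M) l [], h) ∧
    f.Consistent e M (f'.history (f.inducedMediator e M) l []) h)
    ⟨[], rfl, consistent_nil⟩ ?_ j
  rintro m ⟨h, hrun, hc⟩
  obtain ⟨h₁, hrun₁, hc₁⟩ := hc.run_simulateAct f' m.1
  refine ⟨h₁, ?_, by rwa [history_append_singleton]⟩
  rw [MemoryStrategy.run_along_path_append, MemoryStrategy.visit, hrun, history_append_singleton]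
  exact congrArg (fun r => (r.1.2, r.2)) hrun₁

theorem visit_simulation (j : D.J) :
    ((f.simulation e f').visit M.extend j).1.1 = f'.playOf (f.inducedMediator e M) j ∧
      ((f.simulation e f').visit M.extend j).2.length ≤ H + 1 := by
  obtain ⟨h, hrun, hc⟩ := f.run_simulation_along e f' M j
  obtain ⟨h₁, hrun₁, hc₁⟩ := hc.run_simulateAct f' j
  have visit_eq : (f.simulation e f').visit M.extend j =
      (f'.act (f.inducedMediator e M) j (f'.arrival (f.inducedMediator e M) j), h₁) := by
    rw [MemoryStrategy.visit, hrun]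
    exact hrun₁
  rw [visit_eq]
  exact ⟨rfl, hc₁.1⟩

theorem playOf_simulation :
    ((f.simulation e f').toUntimed H).playOf M = f'.playOf (f.inducedMediator e M) := by
  funext j
  rw [MemoryStrategy.playOf_toUntimed _ fun j => (f.visit_simulation e f' M j).2]
  exact (f.visit_simulation e f' M j).1

end UntimedStrategy

/-! ### Untimed interactions -/

section UntimedInteractions

variable {D : DecisionProblem} {S : Type*} {H : ℕ}

theorem untimedMap_apply (μ : PMF (UntimedStrategy D S H)) (M : Mediator S H) (σ : D.Seq) :
    untimedMap D μ M σ = pmfExpect μ fun f => D.seqForm (f.playOf M) σ := by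
  simp only [UntimedStrategy.seqForm_playOf]
  rfl

theorem abs_le_one_of_mem_untimedInteractions {φ : Mediator S H → D.Seq → ℝ}
    (hφ : φ ∈ untimedInteractions D S H) (M : Mediator S H) (σ : D.Seq) : |φ M σ| ≤ 1 := by
  obtain ⟨μ, rfl⟩ := hφ
  rw [untimedMap_apply]
  exact abs_pmfExpect_le μ fun f => D.abs_seqForm_le_one _ σ

/-- The function from mediators to sequence-form strategies that applies `φ` to the direct mediator
induced by a strategy drawn from `μ`. -/
noncomputable def viaInducedMediator (e : D.BasicMessage ↪ S) (μ : PMF (UntimedStrategy D S H))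
    (φ : Mediator S H → D.Seq → ℝ) : Mediator S H → D.Seq → ℝ :=
  fun M σ => pmfExpect μ fun f => φ (f.inducedMediator e M) σ

theorem viaInducedMediator_mem_untimedInteractions (e : D.BasicMessage ↪ S)
    (μ : PMF (UntimedStrategy D S H)) {φ : Mediator S H → D.Seq → ℝ}
    (hφ : φ ∈ untimedInteractions D S H) :
    viaInducedMediator e μ φ ∈ untimedInteractions D S H := by
  obtain ⟨μ', rfl⟩ := hφ
  refine ⟨μ.bind fun f => μ'.map fun f' => (f.simulation e f').toUntimed H, ?_⟩
  funext M σ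
  have bounded (f : UntimedStrategy D S H) : |D.seqForm (f.playOf M) σ| ≤ 1 :=
    D.abs_seqForm_le_one _ σ
  rw [untimedMap_apply, pmfExpect_bind _ _ bounded]
  simp only [pmfExpect_map _ _ bounded, UntimedStrategy.playOf_simulation, viaInducedMediator,
    untimedMap_apply]

/-- The untimed interaction of an honest and obedient player, the `φ*` of the direct equilibrium. -/
noncomputable def directInteraction (e : D.BasicMessage ↪ S) (H : ℕ) :
    Mediator S H → D.Seq → ℝ :=
  untimedMap D (PMF.pure (UntimedStrategy.direct e H))

theorem directInteraction_directMediator (e : D.BasicMessage ↪ S) (hH : ∀ j, D.depth j ≤ H)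
    (s : ∀ j, D.A j) :
    directInteraction e H (D.directMediator e H (D.seqForm s)) = D.seqForm s := by
  funext σ
  rw [directInteraction, untimedMap_apply, pmfExpect_pure,
    UntimedStrategy.seqForm_playOf_direct e hH]

theorem viaInducedMediator_directInteraction (e : D.BasicMessage ↪ S) (hH : ∀ j, D.depth j ≤ H)
    (μ : PMF (UntimedStrategy D S H)) :
    viaInducedMediator e μ (directInteraction e H) = untimedMap D μ := by
  funext M σ
  simp only [viaInducedMediator, UntimedStrategy.inducedMediator,
    directInteraction_directMediator e hH, untimedMap_apply]

theorem forall_update_mem_untimedInteractions {ι : Type*} [DecidableEq ι]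
    {D : ι → DecisionProblem} {S : ι → Type*} {H : ι → ℕ}
    {φ : ∀ i, Mediator (S i) (H i) → (D i).Seq → ℝ}
    (hφ : ∀ i, φ i ∈ untimedInteractions (D i) (S i) (H i))
    {i : ι} {φ' : Mediator (S i) (H i) → (D i).Seq → ℝ}
    (hφ' : φ' ∈ untimedInteractions (D i) (S i) (H i)) :
    ∀ k, Function.update φ i φ' k ∈ untimedInteractions (D k) (S k) (H k) :=
  (Function.forall_update_iff φ fun k ψ => ψ ∈ untimedInteractions (D k) (S k) (H k)).2
    ⟨hφ', fun k _ => hφ k⟩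

end UntimedInteractions

/-! ### Outcomes and equilibria -/

theorem GameTree.abs_chanceProb_le_one {ι : Type*} {I : ι → Type*} {A : ∀ i, I i → Type*} :
    (T : GameTree I A) → ∀ z : T.Terminal, |T.chanceProb z| ≤ 1
  | leaf, _ => by simp [chanceProb]
  | chance _ p child, z => by
    rw [chanceProb, abs_mul, abs_of_nonneg ENNReal.toReal_nonneg]
    exact mul_le_one₀ (ENNReal.toReal_mono ENNReal.one_ne_top (p.coe_le_one _))
      (abs_nonneg _) (abs_chanceProb_le_one (child z.1) z.2)
  | decision _ _ child, z => abs_chanceProb_le_one (child z.1) z.2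

namespace ExtensiveFormGame

variable {ι : Type*} (G : ExtensiveFormGame ι) [Fintype ι] {S : ι → Type*} {H : ι → ℕ}

theorem abs_reachProb_le_one {x : ∀ i, (G.decisionProblem i).Seq → ℝ} (hx : ∀ i σ, |x i σ| ≤ 1)
    (z : G.Terminal) : |G.reachProb x z| ≤ 1 := by
  rw [reachProb, abs_mul]
  refine mul_le_one₀ (G.tree.abs_chanceProb_le_one z) (abs_nonneg _) ?_
  simpa using abs_prod_le_prod Finset.univ fun i => hx i (G.lastSeq i z)

theorem hasSum_expUtility (π : PMF (∀ i, Mediator (S i) (H i))) (i : ι)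
    {φ : ∀ i, Mediator (S i) (H i) → (G.decisionProblem i).Seq → ℝ}
    (hφ : ∀ i M σ, |φ i M σ| ≤ 1) :
    HasSum (fun M => (π M).toReal * G.expUtility i fun k => φ k (M k))
      (∑ z, G.outcome π φ z * G.utility i z) := by
  simp only [expUtility, Finset.mul_sum, ← mul_assoc]
  exact hasSum_sum fun z _ => (summable_pmf_toReal_mul π fun M =>
    G.abs_reachProb_le_one (fun k => hφ k (M k)) z).hasSum.mul_right _

open Classical in
theorem isUntimedEquilibrium_iff_outcome {π : PMF (∀ i, Mediator (S i) (H i))}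
    {φ : ∀ i, Mediator (S i) (H i) → (G.decisionProblem i).Seq → ℝ} :
    G.IsUntimedEquilibrium π φ ↔
      (∀ i, φ i ∈ untimedInteractions (G.decisionProblem i) (S i) (H i)) ∧
      ∀ i, ∀ φ' ∈ untimedInteractions (G.decisionProblem i) (S i) (H i),
        ∑ z, G.outcome π (Function.update φ i φ') z * G.utility i z ≤
          ∑ z, G.outcome π φ z * G.utility i z := by
  refine and_congr_right fun hφ => forall₃_congr fun i φ' hφ' => ?_
  have gain := (G.hasSum_expUtility π i fun k => abs_le_one_of_mem_untimedInteractions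
      (forall_update_mem_untimedInteractions hφ hφ' k)).sub
    (G.hasSum_expUtility π i fun k => abs_le_one_of_mem_untimedInteractions (hφ k))
  simp only [← mul_sub] at gain
  rw [pmfExpect, gain.tsum_eq, sub_nonpos]

/-- The distribution over profiles of direct mediators that arises when mediators are drawn from
`π`, strategies are drawn independently from `μ i`, and each player gets the direct mediator of the
pure strategy to which the interaction amounts. -/
noncomputable def revelation (e : ∀ i, (G.decisionProblem i).BasicMessage ↪ S i)
    (π : PMF (∀ i, Mediator (S i) (H i)))
    (μ : ∀ i, PMF (UntimedStrategy (G.decisionProblem i) (S i) (H i))) :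
    PMF (∀ i, Mediator (S i) (H i)) :=
  π.bind fun M => (productPMF μ).map fun f i => (f i).inducedMediator (e i) (M i)

variable (e : ∀ i, (G.decisionProblem i).BasicMessage ↪ S i)
  (π : PMF (∀ i, Mediator (S i) (H i)))
  (μ : ∀ i, PMF (UntimedStrategy (G.decisionProblem i) (S i) (H i)))

theorem exists_eq_directMediator_of_mem_support_revelation {M : ∀ i, Mediator (S i) (H i)}
    (hM : M ∈ (G.revelation e π μ).support) (i : ι) :
    ∃ x ∈ (G.decisionProblem i).pureStrategies,
      M i = (G.decisionProblem i).directMediator (e i) (H i) x := by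
  obtain ⟨M₀, -, hM⟩ := (PMF.mem_support_bind_iff _ _ _).1 hM
  obtain ⟨f, -, rfl⟩ := (PMF.mem_support_map_iff _ _ _).1 hM
  exact ⟨_, ⟨_, rfl⟩, rfl⟩

theorem outcome_revelation
    {φ : ∀ i, Mediator (S i) (H i) → (G.decisionProblem i).Seq → ℝ}
    (hφ : ∀ i, φ i ∈ untimedInteractions (G.decisionProblem i) (S i) (H i)) :
    G.outcome (G.revelation e π μ) φ =
      G.outcome π fun i => viaInducedMediator (e i) (μ i) (φ i) := by
  funext z
  have bounded (M : ∀ i, Mediator (S i) (H i)) : |G.reachProb (fun k => φ k (M k)) z| ≤ 1 :=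
    G.abs_reachProb_le_one (fun k => abs_le_one_of_mem_untimedInteractions (hφ k) _) z
  rw [outcome, revelation, pmfExpect_bind _ _ bounded, outcome]
  refine congrArg _ (funext fun M => ?_)
  rw [pmfExpect_map _ _ bounded]
  simp only [reachProb, pmfExpect_mul_left, viaInducedMediator]
  rw [← pmfExpect_productPMF μ fun i f => abs_le_one_of_mem_untimedInteractions (hφ i) _ _]

open Classical in
theorem outcome_revelation_update
    {φ : ∀ i, Mediator (S i) (H i) → (G.decisionProblem i).Seq → ℝ}
    (hφ : ∀ i, φ i ∈ untimedInteractions (G.decisionProblem i) (S i) (H i))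
    {i : ι} {φ' : Mediator (S i) (H i) → (G.decisionProblem i).Seq → ℝ}
    (hφ' : φ' ∈ untimedInteractions (G.decisionProblem i) (S i) (H i)) :
    G.outcome (G.revelation e π μ) (Function.update φ i φ') =
      G.outcome π (Function.update (fun k => viaInducedMediator (e k) (μ k) (φ k)) i
        (viaInducedMediator (e i) (μ i) φ')) := by
  rw [G.outcome_revelation e π μ (forall_update_mem_untimedInteractions hφ hφ')]
  exact congrArg _ (funext fun k =>
    Function.apply_update (fun k => viaInducedMediator (e k) (μ k)) φ i φ' k)

end ExtensiveFormGame

theorem mainTheorem3 {ι : Type*} [Fintype ι] (G : ExtensiveFormGame ι)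
    (S : ι → Type*) (H : ι → ℕ)
    (e : ∀ i, (G.decisionProblem i).BasicMessage ↪ S i)
    (hH : ∀ i j, (G.decisionProblem i).depth j ≤ H i)
    (π : PMF (∀ i, Mediator (S i) (H i)))
    (φ : ∀ i, Mediator (S i) (H i) → (G.decisionProblem i).Seq → ℝ)
    (hπ : G.IsUntimedEquilibrium π φ) :
    ∃ (π' : PMF (∀ i, Mediator (S i) (H i)))
      (φ' : ∀ i, Mediator (S i) (H i) → (G.decisionProblem i).Seq → ℝ),
      G.IsUntimedEquilibrium π' φ' ∧ G.IsDirect e π' φ' ∧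
        ∀ z, G.outcome π' φ' z = G.outcome π φ z := by
  obtain ⟨hφ, no_gain⟩ := G.isUntimedEquilibrium_iff_outcome.1 hπ
  choose μ hμ using hφ
  obtain rfl : (fun i => untimedMap (G.decisionProblem i) (μ i)) = φ := funext hμ
  have direct_mem (i : ι) : directInteraction (e i) (H i) ∈
      untimedInteractions (G.decisionProblem i) (S i) (H i) := ⟨_, rfl⟩
  have outcome_eq := G.outcome_revelation e π μ direct_mem
  have via_direct (i : ι) := viaInducedMediator_directInteraction (e i) (hH i) (μ i)
  simp only [via_direct] at outcome_eq
  refine ⟨G.revelation e π μ, fun i => directInteraction (e i) (H i),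
    G.isUntimedEquilibrium_iff_outcome.2 ⟨direct_mem, fun i φ' hφ' => ?_⟩,
    ⟨fun M hM => G.exists_eq_directMediator_of_mem_support_revelation e π μ hM, ?_⟩,
    congrFun outcome_eq⟩
  · rw [outcome_eq, G.outcome_revelation_update e π μ direct_mem hφ']
    simp only [via_direct]
    exact no_gain i _ (viaInducedMediator_mem_untimedInteractions (e i) (μ i) hφ')
  · rintro i _ ⟨s, rfl⟩
    exact directInteraction_directMediator (e i) (hH i) s
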